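/- Let $(D_\lambda)_{\lambda\in\Lambda}$ be a family of Prüfer domains (integral domains in which every nonzero finitely generated ideal is invertible) and let $R=\prod_{\lambda\in\Lambda}D_\lambda$. Let $\max(D_\lambda)$ be the set of maximal ideals of $D_\lambda$, and let $\mathcal B=\prod_{\lambda\in\Lambda}\mathcal P(\max(D_\lambda))$ be the product of the power set Boolean algebras, with componentwise operations. Let $\mathcal F$ be an ultrafilter on $\Lambda$ that is countably incomplete, i.e. there is a countable partition $(P_n)_{n\in\mathbb N}$ of $\Lambda$ (empty parts allowed) with $P_n\notin\mathcal F$ for every $n$, and put $(0)_{\mathcal F}=\{x\in R : \{\lambda\in\Lambda : x_\lambda=0\}\in\mathcal F\}$, an ideal of $R$. Let $\mathcal U$ be an ultrafilter in the Boolean algebra $\mathcal B$ such that $$\mathcal F=\mathcal F_{\mathcal U}:=\bigl\{\{\lambda\in\Lambda : Y_\lambda\neq\emptyset\} : Y\in\mathcal U\bigr\},$$ and suppose that there are $Y\in\mathcal U$ and $N\in\mathbb N$ with $|Y_\lambda|\le N$ for all $\lambda\in\Lambda$. Then for every prime ideal $P\subseteq R$ with $(0)_{\mathcal F}\subsetneq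 P$ there is a prime ideal $Q\subseteq R$ with $(0)_{\mathcal F}\subsetneq Q\subsetneq P$. In particular, every prime ideal of $R$ strictly containing $(0)_{\mathcal F}$ has infinite height. -/

import Mathlib

/-- A Prüfer domain: an integral domain in which every nonzero finitely generated ideal is
invertible (as a fractional ideal of the field of fractions). -/
structure IsPruferDomain (D : Type*) [CommRing D] : Prop where
  isDomain : IsDomain D
  isUnit_of_fg : ∀ I : Ideal D, I.FG → I ≠ ⊥ →
    IsUnit (I : FractionalIdeal (nonZeroDivisors D) (FractionRing D))

/-- `U` is an ultrafilter in the Boolean algebra `B`. -/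
structure IsUltrafilterIn {B : Type*} [BooleanAlgebra B] (U : Set B) : Prop where
  nonempty : U.Nonempty
  bot_notMem : ⊥ ∉ U
  inf_mem : ∀ X ∈ U, ∀ Y ∈ U, X ⊓ Y ∈ U
  mem_of_le : ∀ Y ∈ U, ∀ Z, Y ≤ Z → Z ∈ U
  mem_or_compl_mem : ∀ Y, Y ∈ U ∨ Yᶜ ∈ U

/-- An ultrafilter on a set is countably incomplete if there is a countable partition of the set
(empty parts are allowed) none of whose parts belongs to the ultrafilter. -/
def IsCountablyIncomplete {Λ : Type*} (F : Ultrafilter Λ) : Prop :=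
  ∃ P : ℕ → Set Λ, (∀ n, P n ∉ F) ∧ (⋃ n, P n) = Set.univ ∧
    ∀ m n, m ≠ n → P m ∩ P n = ∅

/-- The Boolean algebra `∏ 𝒫(max(D_λ))`, with the componentwise operations. -/
abbrev MaxSubsets {Λ : Type*} (D : Λ → Type*) [∀ i, CommRing (D i)] : Type _ :=
  ∀ i, Set (MaximalSpectrum (D i))

/-- The collection of all sets `{λ | Y_λ ≠ ∅}` with `Y ∈ U`. -/
def inducedSets {Λ : Type*} {D : Λ → Type*} [∀ i, CommRing (D i)]
    (U : Set (MaxSubsets D)) : Set (Set Λ) :=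
  {A | ∃ Y ∈ U, A = {i | (Y i).Nonempty}}

/-- The ideal of all `x` in the product ring with `{λ | x_λ = 0} ∈ F`. -/
def zeroIdeal {Λ : Type*} (D : Λ → Type*) [∀ i, CommRing (D i)] (F : Ultrafilter Λ) :
    Ideal (∀ i, D i) where
  carrier := {x | {i | x i = 0} ∈ F}
  zero_mem' := Filter.Eventually.of_forall fun _ => rfl
  add_mem' := by
    intro x y hx hy
    filter_upwards [hx, hy] with i hxi hyi
    have h1 : x i = 0 := hxi
    have h2 : y i = 0 := hyi
    simp [h1, h2]
  smul_mem' := by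
    intro c x hx
    filter_upwards [hx] with i hxi
    have h1 : x i = 0 := hxi
    simp [h1]

/-! Modulo `zeroIdeal D F` the product becomes an ultraproduct of domains, hence a domain, and
countable incompleteness supplies an infinite exponent `n`. For nonzero `x` in `P`, the element `x ^
n` is nonzero but divisible by every `x ^ k`, so a prime inside `P` can contain it while avoiding
`x`. Iterating this descent forces infinite height. -/

/-- For a countably incomplete ultrafilter there is an index function to `ℕ` that exceeds every
constant almost everywhere. -/
theorem IsCountablyIncomplete.exists_tendsto_atTop {Λ : Type*} {F : Ultrafilter Λ}
    (hF : IsCountablyIncomplete F) : ∃ n : Λ → ℕ, Filter.Tendsto n F Filter.atTop := by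
  obtain ⟨P, hP, hcover, -⟩ := hF
  have hmem : ∀ i, ∃ n, i ∈ P n := fun i => Set.mem_iUnion.1 (hcover ▸ Set.mem_univ i)
  choose n hn using hmem
  refine ⟨n, Filter.tendsto_atTop.2 fun k => ?_⟩
  -- `n i < k` puts `i` in one of the first `k` parts, a finite union of sets outside `F`.
  have hsmall : ∀ᶠ i in (F : Filter Λ), ∀ m ∈ Finset.range k, i ∉ P m :=
    (Finset.eventually_all _).2 fun m _ => Ultrafilter.eventually_not.2 (hP m)
  filter_upwards [hsmall] with i hi
  by_contra hlt
  exact hi (n i) (Finset.mem_range.2 (not_le.1 hlt)) (hn i)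

theorem mem_zeroIdeal {Λ : Type*} {D : Λ → Type*} [∀ i, CommRing (D i)] {F : Ultrafilter Λ}
    {x : ∀ i, D i} : x ∈ zeroIdeal D F ↔ ∀ᶠ i in (F : Filter Λ), x i = 0 :=
  Iff.rfl

/-- In a product of integral domains, a prime ideal strictly above `zeroIdeal D F` strictly
contains another such prime ideal, if `F` is countably incomplete: if `x ∈ P` is nonzero modulo
`F`, some prime contains a power of `x` of infinite nonstandard exponent, but not `x`. -/
theorem exists_isPrime_between {Λ : Type*} (D : Λ → Type*) [∀ i, CommRing (D i)]
    [∀ i, IsDomain (D i)] {F : Ultrafilter Λ} (hF : IsCountablyIncomplete F)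
    (P : Ideal (∀ i, D i)) [hP : P.IsPrime] (hlt : zeroIdeal D F < P) :
    ∃ Q : Ideal (∀ i, D i), Q.IsPrime ∧ zeroIdeal D F < Q ∧ Q < P := by
  obtain ⟨hle, x, hxP, hx⟩ := SetLike.lt_iff_le_and_exists.1 hlt
  have hx0 : ∀ᶠ i in (F : Filter Λ), x i ≠ 0 := Ultrafilter.eventually_not.2 hx
  obtain ⟨n, hn⟩ := hF.exists_tendsto_atTop
  let y : ∀ i, D i := fun i => x i ^ n i
  have hy : y ∉ zeroIdeal D F := by
    refine Ultrafilter.eventually_not.1 ?_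
    filter_upwards [hx0] with i hi
    exact pow_ne_zero _ hi
  -- Avoiding all products `s * x ^ k` with `s ∉ P` secures both `Q ≤ P` and `x ∉ Q`.
  have hdisj : Disjoint ((zeroIdeal D F ⊔ Ideal.span {y} : Ideal _) : Set (∀ i, D i))
      (P.primeCompl ⊔ Submonoid.powers x : Submonoid _) := by
    rw [Set.disjoint_left]
    intro t ht ht'
    obtain ⟨s, hs, _, ⟨k, rfl⟩, rfl⟩ := Submonoid.mem_sup.1 ht'
    obtain ⟨z, hz, w, hw, hzw⟩ := Submodule.mem_sup.1 ht
    obtain ⟨r, rfl⟩ := Ideal.mem_span_singleton'.1 hw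
    -- Cancel `x ^ k` from `s * x ^ k = r * x ^ n` modulo `F`; the `+ 1` keeps a factor `x`, forcing
    -- `s ∈ P`. Truncated subtraction matters only where `n i ≤ k`, an `F`-null set.
    have key : s - x * (fun i => r i * x i ^ (n i - (k + 1))) ∈ zeroIdeal D F := by
      rw [mem_zeroIdeal]
      filter_upwards [hx0, mem_zeroIdeal.1 hz, hn.eventually_ge_atTop (k + 1)] with i hxi hzi hni
      have h := congrFun hzw i
      simp only [Pi.add_apply, Pi.mul_apply, Pi.pow_apply, hzi, zero_add, y] at h
      refine mul_right_cancel₀ (pow_ne_zero k hxi) ?_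
      simp only [Pi.sub_apply, Pi.mul_apply]
      rw [sub_mul, zero_mul, ← h, ← Nat.sub_add_cancel hni, Nat.add_sub_cancel]
      ring
    exact hs ((Submodule.sub_mem_iff_left P (P.mul_mem_right _ hxP)).1 (hle key))
  obtain ⟨Q, hQ, hJQ, hQS⟩ := Ideal.exists_le_prime_disjoint _ _ hdisj
  have hyQ : y ∈ Q := hJQ (Ideal.mem_sup_right (Ideal.mem_span_singleton_self y))
  have hxQ : x ∉ Q := fun h => Set.disjoint_left.1 hQS h
    ((le_sup_right : Submonoid.powers x ≤ P.primeCompl ⊔ _) (Submonoid.mem_powers x))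
  have hQP : Q ≤ P := fun t ht => by
    by_contra htP
    exact Set.disjoint_left.1 hQS ht ((le_sup_left : P.primeCompl ≤ _ ⊔ Submonoid.powers x) htP)
  exact ⟨Q, hQ, SetLike.lt_iff_le_and_exists.2 ⟨le_sup_left.trans hJQ, y, hyQ, hy⟩,
    SetLike.lt_iff_le_and_exists.2 ⟨hQP, x, hxP, hxQ⟩⟩

/-- If no prime strictly above `I` is minimal with that property, all such primes have infinite
height. -/
theorem Ideal.height_eq_top_of_forall_exists_lt {R : Type*} [CommRing R] {I : Ideal R}
    (h : ∀ P : Ideal R, P.IsPrime → I < P → ∃ Q : Ideal R, Q.IsPrime ∧ I < Q ∧ Q < P)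
    (P : Ideal R) (hP : P.IsPrime) (hIP : I < P) : P.height = ⊤ := by
  refine ENat.eq_top_iff_forall_ge.2 fun m => ?_
  induction m generalizing P with
  | zero => simp
  | succ m ih =>
    obtain ⟨Q, hQ, hIQ, hQP⟩ := h P hP hIP
    push_cast
    exact (add_le_add_left (ih Q hQ hIQ) 1).trans
      (Ideal.height_add_one_le_of_lt_of_isPrime hQP)

theorem theorem3p8 {Λ : Type*} (D : Λ → Type*) [∀ i, CommRing (D i)]
    (hD : ∀ i, IsPruferDomain (D i))
    (F : Ultrafilter Λ) (hF : IsCountablyIncomplete F)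
    (U : Set (MaxSubsets D)) (hU : IsUltrafilterIn U)
    (hFU : inducedSets U = {A : Set Λ | A ∈ F})
    (hbound : ∃ Y ∈ U, ∃ N : ℕ, ∀ i, (Y i).encard ≤ N) :
    (∀ P : Ideal (∀ i, D i), P.IsPrime → zeroIdeal D F < P →
      ∃ Q : Ideal (∀ i, D i), Q.IsPrime ∧ zeroIdeal D F < Q ∧ Q < P) ∧
    (∀ P : Ideal (∀ i, D i), P.IsPrime → zeroIdeal D F < P → P.height = ⊤) := by
  have _ := fun i => (hD i).isDomain
  have hbetween := fun P (_ : Ideal.IsPrime P) => exists_isPrime_between D hF P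
  exact ⟨hbetween, Ideal.height_eq_top_of_forall_exists_lt hbetween⟩
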